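/- Let $d\ge 1$, $1/2<H<1$ and $\alpha_H=H(2H-1)$. Let $X=(X_t)_{t\ge 0}$ be an $\mathbb{R}^d$-valued L\'evy process with characteristic exponent $\Psi$, i.e. $E[e^{-i\xi\cdot X_t}]=e^{-t\Psi(\xi)}$ for all $t>0$ and $\xi\in\mathbb{R}^d$, and suppose that for every $t>0$ the law of $X_t$ has a density $p_t\in L^2(\mathbb{R}^d)$. Let $\bar X_t=X_t-\tilde X_t$, where $\tilde X$ is an independent copy of $X$, let $(\bar P_t\phi)(x)=E[\phi(x+\bar X_t)]$ be the semigroup of $\bar X$, acting on measurable functions $\phi:\mathbb{R}^d\to[0,\infty]$, and for $\alpha>0$ set $$(\bar R_{\alpha,H}\phi)(x)=\alpha_H\int_0^\infty\int_0^\infty |r-s|^{2H-2}e^{-\alpha(r+s)}(\bar P_{r+s}\phi)(x)\,dr\,ds\in[0,\infty].$$ Let $f:\mathbb{R}^d\to[0,\infty]$ be a measurable, locally integrable function which is the Fourier transform, in the space of tempered distributions, of a tempered measure $\mu$, i.e. $$\int_{\mathbb{R}^d}f(x)\varphi(x)\,dx=\int_{\mathbb{R}^d}\mathcal{F}\varphi(\xi)\,\mu(d\xi)\quad\text{for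 every Schwartz function }\varphi,\qquad \mathcal{F}\varphi(\xi)=\int_{\mathbb{R}^d}e^{-i\xi\cdot x}\varphi(x)\,dx,$$ and suppose that $\mu$ has a non-negative density with respect to Lebesgue measure. Suppose finally that $f(x)<\infty$ if and only if $x\ne 0$. Then $$\int_{\mathbb{R}^d}\left(\frac{1}{1+\operatorname{Re}\Psi(\xi)}\right)^{2H}\mu(d\xi)<\infty$$ if and only if $(\bar R_{\alpha,H}f)(0)<\infty$ for every $\alpha>0$. -/

import Mathlib

open MeasureTheory ProbabilityTheory Filter Topology
open scoped NNReal ENNReal SchwartzMap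

noncomputable section

namespace FractionalSPDE

/-- A Lévy process with values in `ℝ^d`, indexed by `[0, ∞)`. -/
structure IsLevyProcess {d : ℕ} {Ω : Type*} [MeasurableSpace Ω]
    (X : ℝ≥0 → Ω → EuclideanSpace ℝ (Fin d)) (P : Measure Ω) : Prop where
  measurable : ∀ t, Measurable (X t)
  start_zero : ∀ᵐ ω ∂P, X 0 ω = 0
  indep_increments : HasIndepIncrements X P
  stationary_increments : ∀ s t, IdentDistrib (fun ω => X (s + t) ω - X s ω) (X t) P P
  stoch_continuous : ∀ t, TendstoInMeasure P X (𝓝 t) (X t)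
  cadlag : ∀ᵐ ω ∂P, ∀ t, ContinuousWithinAt (fun s => X s ω) (Set.Ici t) t ∧
    ∃ l, Tendsto (fun s => X s ω) (𝓝[<] t) (𝓝 l)

/-- `Ψ` is the characteristic exponent of `X`, in the convention
`E[exp(-i ξ · X_t)] = exp(-t Ψ(ξ))`. (These equations, for all `t > 0`, determine `Ψ`.) -/
def IsCharExponent {d : ℕ} {Ω : Type*} [MeasurableSpace Ω]
    (X : ℝ≥0 → Ω → EuclideanSpace ℝ (Fin d)) (P : Measure Ω)
    (Ψ : EuclideanSpace ℝ (Fin d) → ℂ) : Prop :=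
  ∀ t : ℝ≥0, 0 < t → ∀ ξ : EuclideanSpace ℝ (Fin d),
    ∫ ω, Complex.exp (-Complex.I * ((inner ℝ ξ (X t ω) : ℝ) : ℂ)) ∂P
      = Complex.exp (-(((t : ℝ) : ℂ)) * Ψ ξ)

/-- For every `t > 0` the law of `X_t` has a density `p_t`, and `p_t ∈ L²(ℝ^d)`. -/
def HasL2Densities {d : ℕ} {Ω : Type*} [MeasurableSpace Ω]
    (X : ℝ≥0 → Ω → EuclideanSpace ℝ (Fin d)) (P : Measure Ω) : Prop :=
  ∀ t : ℝ≥0, 0 < t → ∃ p : EuclideanSpace ℝ (Fin d) → ℝ,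
    Measurable p ∧ (∀ x, 0 ≤ p x) ∧
    P.map (X t) = volume.withDensity (fun x => ENNReal.ofReal (p x)) ∧
    MemLp p 2 volume

/-- The symmetrization `X̄_t = X_t - X̃_t` of `X`, where `X̃` is an independent copy of `X`;
it is realized on the product space, and so considered under `P.prod P`. -/
def symmetrization {d : ℕ} {Ω : Type*} (X : ℝ≥0 → Ω → EuclideanSpace ℝ (Fin d)) :
    ℝ≥0 → Ω × Ω → EuclideanSpace ℝ (Fin d) :=
  fun t ω => X t ω.1 - X t ω.2

/-- The transition semigroup `(P_t φ)(x) = E[φ(x + X_t)]`, on functions with values in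
`[0, ∞]`. -/
def semigroup {d : ℕ} {Ω : Type*} [MeasurableSpace Ω]
    (X : ℝ≥0 → Ω → EuclideanSpace ℝ (Fin d)) (P : Measure Ω) (t : ℝ≥0)
    (φ : EuclideanSpace ℝ (Fin d) → ℝ≥0∞) (x : EuclideanSpace ℝ (Fin d)) : ℝ≥0∞ :=
  ∫⁻ ω, φ (x + X t ω) ∂P

/-- The semigroup `(P̄_t)` of the symmetrization of `X`. -/
def symmSemigroup {d : ℕ} {Ω : Type*} [MeasurableSpace Ω]
    (X : ℝ≥0 → Ω → EuclideanSpace ℝ (Fin d)) (P : Measure Ω) (t : ℝ≥0)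
    (φ : EuclideanSpace ℝ (Fin d) → ℝ≥0∞) (x : EuclideanSpace ℝ (Fin d)) : ℝ≥0∞ :=
  semigroup (symmetrization X) (P.prod P) t φ x

/-- The fractional resolvent of the symmetrization of `X`:
`(R̄_{α,H} φ)(x) = α_H ∫_0^∞ ∫_0^∞ |r - s|^{2H-2} e^{-α(r+s)} (P̄_{r+s} φ)(x) dr ds`
with `α_H = H(2H - 1)`, as an element of `[0, ∞]`. -/
def fracResolvent {d : ℕ} {Ω : Type*} [MeasurableSpace Ω]
    (X : ℝ≥0 → Ω → EuclideanSpace ℝ (Fin d)) (P : Measure Ω) (H α : ℝ)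
    (φ : EuclideanSpace ℝ (Fin d) → ℝ≥0∞) (x : EuclideanSpace ℝ (Fin d)) : ℝ≥0∞ :=
  ENNReal.ofReal (H * (2 * H - 1)) *
    ∫⁻ s in Set.Ioi (0 : ℝ), ∫⁻ r in Set.Ioi (0 : ℝ),
      ENNReal.ofReal (|r - s| ^ (2 * H - 2)) * ENNReal.ofReal (Real.exp (-α * (r + s))) *
        symmSemigroup X P (r + s).toNNReal φ x

/-- The Fourier transform in the convention `(F φ)(ξ) = ∫ e^{-i ξ · x} φ(x) dx`. -/
def fourierInt {d : ℕ} (φ : EuclideanSpace ℝ (Fin d) → ℂ) (ξ : EuclideanSpace ℝ (Fin d)) : ℂ :=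
  ∫ x, Complex.exp (-Complex.I * ((inner ℝ ξ x : ℝ) : ℂ)) * φ x

/-- `f : ℝ^d → [0, ∞]` is a measurable, locally integrable function which is the Fourier
transform, in the space of tempered distributions, of the tempered measure `μ`:
`∫ f(x) φ(x) dx = ∫ (F φ)(ξ) μ(dξ)` for all Schwartz functions `φ`. -/
structure IsKernelWithSpectralMeasure {d : ℕ} (f : EuclideanSpace ℝ (Fin d) → ℝ≥0∞)
    (μ : Measure (EuclideanSpace ℝ (Fin d))) : Prop where
  measurable : Measurable f
  locally_integrable : ∀ K : Set (EuclideanSpace ℝ (Fin d)), IsCompact K → ∫⁻ x in K, f x < ∞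
  tempered : μ.HasTemperateGrowth
  integrable_mul : ∀ φ : 𝓢(EuclideanSpace ℝ (Fin d), ℂ),
    Integrable (fun x => ((f x).toReal : ℂ) * φ x)
  fourier_eq : ∀ φ : 𝓢(EuclideanSpace ℝ (Fin d), ℂ),
    ∫ x, ((f x).toReal : ℂ) * φ x = ∫ ξ, fourierInt φ ξ ∂μ

end FractionalSPDE

end

/-! The heart of the matter is the closed formula `fracResolvent_zero_eq_lintegral`: with ρ = Re Ψ,
the fractional resolvent of f at 0 equals α_H Γ(2H-1) ∫ (α + 2ρ)^(-2H) dμ. For each α > 0 the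
integrand is comparable to (1 + ρ)^(-2H), up to constants depending on α and H, and the equivalence
follows.

Since p_t is in L², the symmetrization has the bounded continuous density x ↦ ∫ p_t(z + x) p_t(z)
dz, with Fourier transform |exp(-tΨ)|² = exp(-2tρ) ≥ 0. Parseval's identity then gives (P̄_t f)(0) =
∫ exp(-2tρ) dμ (`symmSemigroup_zero_eq_lintegral`), and Tonelli reduces the resolvent to the
integral of |r-s|^(2H-2) exp(-(α + 2ρ)(r + s)) over the quadrant, a Gamma integral.

The delicate point is Parseval (`lintegral_mul_eq_lintegral_fourier`): the density need not be
Schwartz and both sides may be infinite. Only Gaussians are ever used as test functions. Mollifying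
the density damps μ by a Gaussian and makes Fubini legitimate. Removing the mollifier gives "≤" by
Fatou, and "≥" for densities with Gaussian decay. Multiplying a general density by a wide Gaussian
reduces it to that case, because its transform becomes a Gaussian average of a non-negative function
and so stays non-negative. -/

noncomputable section

namespace FractionalSPDE

/-! ### Gaussians as Schwartz functions, and their Fourier transforms. -/

section Gaussian

/-- The triangle inequality combined with (a + b)² ≤ 2a² + 2b². It shows that translating a
Gaussian, or convolving with a narrow one, costs only half of the exponent. -/
lemma norm_sq_half_sub_le {V : Type*} [NormedAddCommGroup V] (x y : V) : ‖y‖ ^ 2 / 2 - ‖x‖ ^ 2 ≤ ‖y - x‖ ^ 2 := by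
  have h1 : ‖y‖ ≤ ‖y - x‖ + ‖x‖ := by simpa using norm_add_le (y - x) x
  nlinarith [norm_nonneg y, norm_nonneg (y - x), norm_nonneg x, sq_nonneg (‖y - x‖ - ‖x‖)]

variable {V : Type*} [NormedAddCommGroup V] [InnerProductSpace ℝ V]

/-- Polynomials times Gaussians are bounded. -/
lemma exists_bound_one_add_pow_mul_exp {b : ℝ} (hb : 0 < b) (m : ℕ) :
    ∃ C : ℝ, ∀ r : ℝ, 0 ≤ r → (1 + r) ^ m * Real.exp (-b * r ^ 2) ≤ C := by
  -- From (1 + r)^m ≤ m! e^(1+r) and, completing the square, r - b r² ≤ 1/(4b).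
  refine ⟨(m.factorial : ℝ) * Real.exp (1 + 1 / (4 * b)), fun r hr => ?_⟩
  have h1 : (1 + r) ^ m ≤ m.factorial * Real.exp (1 + r) := by
    have := Real.pow_div_factorial_le_exp (1 + r) (by positivity) m
    rwa [div_le_iff₀ (by positivity), mul_comm] at this
  calc (1 + r) ^ m * Real.exp (-b * r ^ 2)
      ≤ m.factorial * Real.exp (1 + r) * Real.exp (-b * r ^ 2) := by gcongr
    _ = m.factorial * Real.exp (1 + r + -b * r ^ 2) := by rw [mul_assoc, ← Real.exp_add]
    _ ≤ _ := by
        refine mul_le_mul_of_nonneg_left (Real.exp_le_exp.2 ?_) (by positivity)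
        have : b * (r - 1 / (2 * b)) ^ 2 = b * r ^ 2 - r + 1 / (4 * b) := by
          field_simp; ring
        nlinarith [mul_nonneg hb.le (sq_nonneg (r - 1 / (2 * b)))]

/-- The exponential of a function of temperate growth which is bounded above by a negative
definite quadratic function is a Schwartz function. -/
lemma exists_schwartzMap_eq_exp {u : V → ℝ} (hu : u.HasTemperateGrowth) {A b : ℝ} (hb : 0 < b)
    (hub : ∀ y, u y ≤ A - b * ‖y‖ ^ 2) :
    ∃ φ : 𝓢(V, ℂ), ∀ y, φ y = (Real.exp (u y) : ℂ) := by
  have hsm : ContDiff ℝ (⊤ : ℕ∞) u := hu.1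
  have hexp : ContDiff ℝ (⊤ : ℕ∞) fun y => Real.exp (u y) := Real.contDiff_exp.comp hsm
  refine ⟨⟨fun y => (Real.exp (u y) : ℂ), Complex.ofRealCLM.contDiff.comp hexp, ?_⟩, fun y => rfl⟩
  intro k n
  obtain ⟨p, C, hC, hbound⟩ := hu.norm_iteratedFDeriv_le_uniform n
  obtain ⟨M, hM⟩ := exists_bound_one_add_pow_mul_exp hb (k + p * n)
  refine ⟨n.factorial * (max C 1) ^ n * Real.exp A * M, fun x => ?_⟩
  have h0 : ‖iteratedFDeriv ℝ n (fun y => (Real.exp (u y) : ℂ)) x‖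
      = ‖iteratedFDeriv ℝ n (fun y => Real.exp (u y)) x‖ :=
    Complex.ofRealLI.norm_iteratedFDeriv_comp_left (hexp.contDiffAt) (mod_cast le_top)
  have hx : (1 : ℝ) ≤ (1 + ‖x‖) ^ p := one_le_pow₀ (by linarith [norm_nonneg x])
  -- Faà di Bruno bound: every derivative of `exp` at `u x` is `exp (u x)`. The constant `max C 1`
  -- makes the base at least 1, so the bound on the `i`-th derivative may be replaced by its `i`-th
  -- power, `i ≥ 1`.
  have h1 : ‖iteratedFDeriv ℝ n (Real.exp ∘ u) x‖
      ≤ n.factorial * Real.exp (u x) * (max C 1 * (1 + ‖x‖) ^ p) ^ n := by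
    refine norm_iteratedFDeriv_comp_le (N := ((⊤ : ℕ∞) : WithTop ℕ∞)) Real.contDiff_exp hsm
      (mod_cast le_top) x ?_ ?_
    · intro i _
      rw [norm_iteratedFDeriv_eq_norm_iteratedDeriv, iteratedDeriv_eq_iterate,
        Real.iter_deriv_exp]
      simp
    · intro i hi hin
      calc ‖iteratedFDeriv ℝ i u x‖ ≤ C * (1 + ‖x‖) ^ p := hbound i hin x
        _ ≤ max C 1 * (1 + ‖x‖) ^ p := by gcongr; exact le_max_left _ _
        _ ≤ _ := le_self_pow₀ (one_le_mul_of_one_le_of_one_le (le_max_right _ _) hx) (by lia)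
  have h2 := hM ‖x‖ (norm_nonneg x)
  rw [h0]
  calc ‖x‖ ^ k * ‖iteratedFDeriv ℝ n (fun y => Real.exp (u y)) x‖
      ≤ (1 + ‖x‖) ^ k * (n.factorial * Real.exp (A - b * ‖x‖ ^ 2)
          * (max C 1 * (1 + ‖x‖) ^ p) ^ n) := by
        gcongr
        · linarith [norm_nonneg x]
        · exact h1.trans (by gcongr; exact hub x)
    _ = n.factorial * (max C 1) ^ n * Real.exp A
          * ((1 + ‖x‖) ^ (k + p * n) * Real.exp (-b * ‖x‖ ^ 2)) := by
        rw [sub_eq_add_neg, Real.exp_add, pow_add, mul_pow, pow_mul, neg_mul]; ring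
    _ ≤ _ := by gcongr

/-- The density of the centred Gaussian law with covariance `(2 * b)⁻¹`. -/
def gaussDensity (b : ℝ) (x : V) : ℝ :=
  (b / Real.pi) ^ (Module.finrank ℝ V / 2 : ℝ) * Real.exp (-b * ‖x‖ ^ 2)

lemma gaussDensity_nonneg {b : ℝ} (hb : 0 < b) (x : V) : 0 ≤ gaussDensity b x := by
  unfold gaussDensity; positivity

lemma continuous_gaussDensity (b : ℝ) : Continuous (gaussDensity b : V → ℝ) := by
  unfold gaussDensity; fun_prop

/-- Half of the exponent is set aside as a decay factor; the other half is renormalized to a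
probability density. -/
lemma gaussDensity_eq_mul (b : ℝ) (hb : 0 < b) (x : V) :
    gaussDensity b x = 2 ^ (Module.finrank ℝ V / 2 : ℝ) * Real.exp (-(b / 2) * ‖x‖ ^ 2)
      * gaussDensity (b / 2) x := by
  unfold gaussDensity
  have h1 : b / Real.pi = 2 * (b / 2 / Real.pi) := by ring
  have h2 : -b * ‖x‖ ^ 2 = -(b / 2) * ‖x‖ ^ 2 + -(b / 2) * ‖x‖ ^ 2 := by ring
  rw [h1, Real.mul_rpow (by norm_num) (by positivity), h2, Real.exp_add]
  ring

lemma exists_schwartzMap_eq_exp_neg_mul_sq {b : ℝ} (hb : 0 < b) (x : V) :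
    ∃ φ : 𝓢(V, ℂ), ∀ y, φ y = (Real.exp (-b * ‖y - x‖ ^ 2) : ℂ) := by
  refine exists_schwartzMap_eq_exp (A := b * ‖x‖ ^ 2) (b := b / 2) ?_ (by positivity) fun y => ?_
  · have h2 : (fun y : V => y - x).HasTemperateGrowth := by fun_prop
    have h3 : (fun y : V => ‖y - x‖ ^ 2).HasTemperateGrowth :=
      (Function.hasTemperateGrowth_norm_sq V).comp h2
    have h4 : (fun _ : V => -b).HasTemperateGrowth := by fun_prop
    exact h4.mul h3
  · nlinarith [norm_sq_half_sub_le x y]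

lemma exists_schwartzMap_eq_gaussDensity {b : ℝ} (hb : 0 < b) (x : V) :
    ∃ φ : 𝓢(V, ℂ), ∀ y, φ y = (gaussDensity b (y - x) : ℂ) := by
  obtain ⟨φ, hφ⟩ := exists_schwartzMap_eq_exp_neg_mul_sq hb x
  refine ⟨((b / Real.pi) ^ (Module.finrank ℝ V / 2 : ℝ) : ℝ) • φ, fun y => ?_⟩
  simp [hφ, gaussDensity]

variable [FiniteDimensional ℝ V] [MeasurableSpace V] [BorelSpace V]

lemma integral_cexp_inner_mul_gaussDensity {b : ℝ} (hb : 0 < b) (ξ : V) :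
    ∫ x, Complex.exp (-Complex.I * ((inner ℝ ξ x : ℝ) : ℂ)) * (gaussDensity b x : ℂ)
      = (Real.exp (-‖ξ‖ ^ 2 / (4 * b)) : ℂ) := by
  have h := GaussianFourier.integral_cexp_neg_mul_sq_norm_add (V := V) (b := b) (by simpa using hb)
    (-Complex.I) ξ
  have h1 : ∀ x : V, Complex.exp (-Complex.I * ((inner ℝ ξ x : ℝ) : ℂ)) * (gaussDensity b x : ℂ)
      = (((b / Real.pi) ^ (Module.finrank ℝ V / 2 : ℝ) : ℝ) : ℂ) *
        Complex.exp (-b * ‖x‖ ^ 2 + -Complex.I * ((inner ℝ ξ x : ℝ) : ℂ)) := by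
    intro x
    rw [gaussDensity, Complex.exp_add]; push_cast; ring
  simp_rw [h1]
  rw [integral_const_mul, h, ← mul_assoc]
  have h2 : (((b / Real.pi) ^ (Module.finrank ℝ V / 2 : ℝ) : ℝ) : ℂ)
      * ((Real.pi : ℂ) / b) ^ (Module.finrank ℝ V / 2 : ℂ) = 1 := by
    have h3 : ((Real.pi : ℂ) / b) ^ (Module.finrank ℝ V / 2 : ℂ)
        = (((Real.pi / b) ^ (Module.finrank ℝ V / 2 : ℝ) : ℝ) : ℂ) := by
      rw [Complex.ofReal_cpow (by positivity)]; push_cast; rfl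
    rw [h3, ← Complex.ofReal_mul, ← Real.mul_rpow (by positivity) (by positivity)]
    have : b / Real.pi * (Real.pi / b) = 1 := by field_simp
    rw [this]; simp
  rw [h2, one_mul]
  push_cast
  congr 1
  simp

lemma integrable_gaussDensity {b : ℝ} (hb : 0 < b) : Integrable (gaussDensity b : V → ℝ) := by
  obtain ⟨φ, hφ⟩ := exists_schwartzMap_eq_gaussDensity hb (0 : V)
  have := φ.integrable (μ := volume).re
  refine this.congr (.of_forall fun y => ?_)
  simp [hφ]

lemma integral_gaussDensity {b : ℝ} (hb : 0 < b) : ∫ x : V, gaussDensity b x = 1 := by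
  have := integral_cexp_inner_mul_gaussDensity hb (0 : V)
  simp only [inner_zero_left, Complex.ofReal_zero, mul_zero, Complex.exp_zero, one_mul] at this
  rw [integral_complex_ofReal] at this
  simpa using this

lemma lintegral_gaussDensity {b : ℝ} (hb : 0 < b) :
    ∫⁻ x : V, ENNReal.ofReal (gaussDensity b x) = 1 := by
  rw [← ofReal_integral_eq_lintegral_ofReal (integrable_gaussDensity hb)
    (.of_forall fun x => gaussDensity_nonneg hb x), integral_gaussDensity hb, ENNReal.ofReal_one]

end Gaussian

lemma norm_cexp_neg_I_mul_ofReal (r : ℝ) : ‖Complex.exp (-Complex.I * (r : ℂ))‖ = 1 := by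
  rw [Complex.norm_exp]; simp

/-! ### Gaussian mollification of densities. -/

section Mollification

variable {V : Type*} [NormedAddCommGroup V] [InnerProductSpace ℝ V] [FiniteDimensional ℝ V]
  [MeasurableSpace V] [BorelSpace V]

lemma tendsto_lintegral_mul_gaussDensity {φ : V → ℝ} (hφ : Continuous φ) (hφ0 : ∀ x, 0 ≤ φ x)
    (hφi : Integrable φ) (hφb : ∃ M, ∀ x, φ x ≤ M) (y : V) :
    Tendsto (fun b : ℝ => ∫⁻ x, ENNReal.ofReal (φ x * gaussDensity b (y - x))) atTop
      (𝓝 (ENNReal.ofReal (φ y))) := by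
  obtain ⟨M, hM⟩ := hφb
  -- Change of parameter: the approximate identity used here has kernel (πc)^(n/2) exp(-π² c ‖·‖²),
  -- which is `gaussDensity b` for c = b/π².
  have h1 : Tendsto (fun b : ℝ => b / Real.pi ^ 2) atTop atTop :=
    tendsto_id.atTop_div_const (by positivity)
  have h2 := (Real.tendsto_integral_gaussian_smul' (f := fun x => (φ x : ℂ)) hφi.ofReal
    (v := y) (Complex.continuous_ofReal.comp hφ).continuousAt).comp h1
  have h3 : Tendsto (fun b : ℝ => ∫ x, φ x * gaussDensity b (y - x)) atTop (𝓝 (φ y)) := by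
    have h4 := (Complex.continuous_re.tendsto _).comp h2
    simp only [Complex.ofReal_re] at h4
    refine h4.congr' ?_
    filter_upwards [eventually_gt_atTop 0] with b hb
    have h5 : ∀ x : V, ((Real.pi : ℂ) * ((b / Real.pi ^ 2 : ℝ) : ℂ)) ^
        (Module.finrank ℝ V / 2 : ℂ) * Complex.exp (-(Real.pi : ℂ) ^ 2 *
          ((b / Real.pi ^ 2 : ℝ) : ℂ) * (‖y - x‖ : ℂ) ^ 2) * (φ x : ℂ)
        = ((φ x * gaussDensity b (y - x) : ℝ) : ℂ) := by
      intro x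
      have e1 : (Real.pi : ℂ) * ((b / Real.pi ^ 2 : ℝ) : ℂ) = ((b / Real.pi : ℝ) : ℂ) := by
        push_cast; field_simp
      have e2 : -(Real.pi : ℂ) ^ 2 * ((b / Real.pi ^ 2 : ℝ) : ℂ) = ((-b : ℝ) : ℂ) := by
        push_cast; field_simp
      have e3 : ((b / Real.pi : ℝ) : ℂ) ^ (Module.finrank ℝ V / 2 : ℂ)
          = (((b / Real.pi) ^ (Module.finrank ℝ V / 2 : ℝ) : ℝ) : ℂ) := by
        rw [Complex.ofReal_cpow (by positivity)]; push_cast; rfl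
      rw [e1, e2, e3, gaussDensity]
      push_cast; ring
    simp only [Function.comp_apply, smul_eq_mul]
    simp_rw [h5]
    rw [integral_complex_ofReal, Complex.ofReal_re]
  refine (ENNReal.tendsto_ofReal h3).congr' ?_
  filter_upwards [eventually_gt_atTop 0] with b hb
  rw [ofReal_integral_eq_lintegral_ofReal]
  · refine ((integrable_gaussDensity hb).comp_sub_left y).bdd_mul (c := M)
      hφ.aestronglyMeasurable (.of_forall fun x => ?_)
    rw [Real.norm_of_nonneg (hφ0 x)]; exact hM x
  · exact .of_forall fun x => mul_nonneg (hφ0 x) (gaussDensity_nonneg hb _)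

/-- Mollifying a function with Gaussian decay preserves Gaussian decay, uniformly. -/
lemma lintegral_mul_gaussDensity_le {φ : V → ℝ} {M a b : ℝ} (ha : 0 < a) (hab : 2 * a ≤ b)
    (hM : 0 ≤ M) (hφ : ∀ x, φ x ≤ M * Real.exp (-a * ‖x‖ ^ 2)) (y : V) :
    ∫⁻ x, ENNReal.ofReal (φ x * gaussDensity b (y - x)) ≤
      ENNReal.ofReal (M * 2 ^ (Module.finrank ℝ V / 2 : ℝ) * Real.exp (-(a / 2) * ‖y‖ ^ 2)) := by
  have hb : 0 < b := by linarith
  have key : ∀ x, φ x * gaussDensity b (y - x) ≤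
      M * 2 ^ (Module.finrank ℝ V / 2 : ℝ) * Real.exp (-(a / 2) * ‖y‖ ^ 2)
        * gaussDensity (b / 2) (y - x) := by
    intro x
    -- As b/2 ≥ a, the exponent satisfies a‖x‖² + (b/2)‖y - x‖² ≥ a(‖x‖² + ‖y - x‖²) ≥ (a/2)‖y‖².
    have h1 : Real.exp (-a * ‖x‖ ^ 2) * Real.exp (-(b / 2) * ‖y - x‖ ^ 2)
        ≤ Real.exp (-(a / 2) * ‖y‖ ^ 2) := by
      rw [← Real.exp_add, Real.exp_le_exp]
      have := norm_sq_half_sub_le x y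
      nlinarith [sq_nonneg ‖y - x‖, mul_nonneg (sub_nonneg.2 hab) (sq_nonneg ‖y - x‖)]
    calc φ x * gaussDensity b (y - x)
        ≤ M * Real.exp (-a * ‖x‖ ^ 2) * gaussDensity b (y - x) :=
          mul_le_mul_of_nonneg_right (hφ x) (gaussDensity_nonneg hb _)
      _ = M * 2 ^ (Module.finrank ℝ V / 2 : ℝ) * (Real.exp (-a * ‖x‖ ^ 2)
          * Real.exp (-(b / 2) * ‖y - x‖ ^ 2)) * gaussDensity (b / 2) (y - x) := by
          rw [gaussDensity_eq_mul b hb]; ring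
      _ ≤ _ := by
          have := gaussDensity_nonneg (half_pos hb) (y - x)
          gcongr
  calc ∫⁻ x, ENNReal.ofReal (φ x * gaussDensity b (y - x))
      ≤ ∫⁻ x, ENNReal.ofReal (M * 2 ^ (Module.finrank ℝ V / 2 : ℝ)
          * Real.exp (-(a / 2) * ‖y‖ ^ 2)) * ENNReal.ofReal (gaussDensity (b / 2) (y - x)) := by
        refine lintegral_mono fun x => ?_
        rw [← ENNReal.ofReal_mul (by positivity)]
        exact ENNReal.ofReal_le_ofReal (key x)
    _ = _ := by
        rw [lintegral_const_mul' _ _ ENNReal.ofReal_ne_top,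
          lintegral_sub_left_eq_self (fun x => ENNReal.ofReal (gaussDensity (b / 2) x)) y,
          lintegral_gaussDensity (half_pos hb), mul_one]

end Mollification

/-! ### Testing the kernel against Gaussians. -/

section Kernel

variable {d : ℕ} {f : EuclideanSpace ℝ (Fin d) → ℝ≥0∞} {μ : Measure (EuclideanSpace ℝ (Fin d))}

lemma IsKernelWithSpectralMeasure.ae_lt_top (h : IsKernelWithSpectralMeasure f μ) :
    ∀ᵐ x, f x < ∞ := by
  have h1 : ∀ n : ℕ, ∀ᵐ x, x ∈ Metric.closedBall (0 : EuclideanSpace ℝ (Fin d)) n → f x < ∞ :=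
    fun n => (ae_restrict_iff' measurableSet_closedBall).1 (MeasureTheory.ae_lt_top h.measurable
      (h.locally_integrable _ (isCompact_closedBall _ _)).ne)
  filter_upwards [ae_all_iff.2 h1] with x hx
  obtain ⟨n, hn⟩ := exists_nat_ge ‖x‖
  exact hx n (by simpa using hn)

lemma fourierInt_gaussDensity_sub {b : ℝ} (hb : 0 < b) (x ξ : EuclideanSpace ℝ (Fin d)) :
    fourierInt (fun y => (gaussDensity b (y - x) : ℂ)) ξ
      = Complex.exp (-Complex.I * ((inner ℝ ξ x : ℝ) : ℂ))
        * (Real.exp (-‖ξ‖ ^ 2 / (4 * b)) : ℂ) := by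
  rw [fourierInt, ← integral_add_right_eq_self _ x, ← integral_cexp_inner_mul_gaussDensity hb,
    ← integral_const_mul]
  congr with y
  rw [inner_add_right, add_sub_cancel_right, ← mul_assoc, ← Complex.exp_add]
  congr 2
  push_cast; ring

lemma integrable_exp_neg_sq_of_hasTemperateGrowth (h : μ.HasTemperateGrowth) {b : ℝ} (hb : 0 < b) :
    Integrable (fun ξ => Real.exp (-‖ξ‖ ^ 2 / (4 * b))) μ := by
  obtain ⟨φ, hφ⟩ := exists_schwartzMap_eq_exp_neg_mul_sq (b := 1 / (4 * b)) (by positivity)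
    (0 : EuclideanSpace ℝ (Fin d))
  refine (φ.integrable (μ := μ)).re.congr (.of_forall fun y => ?_)
  have : -(1 / (4 * b)) * ‖y - 0‖ ^ 2 = -‖y‖ ^ 2 / (4 * b) := by rw [sub_zero]; ring
  simp only [hφ, this, RCLike.re_to_complex, Complex.ofReal_re]

/-- The defining identity tested on a translated Gaussian: the mollified kernel is an honest
function, the Fourier transform of μ damped to a finite measure. -/
lemma IsKernelWithSpectralMeasure.integral_mul_gaussDensity (h : IsKernelWithSpectralMeasure f μ)
    {b : ℝ} (hb : 0 < b) (x : EuclideanSpace ℝ (Fin d)) :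
    ((∫ y, (f y).toReal * gaussDensity b (y - x) : ℝ) : ℂ)
      = ∫ ξ, Complex.exp (-Complex.I * ((inner ℝ ξ x : ℝ) : ℂ))
          * (Real.exp (-‖ξ‖ ^ 2 / (4 * b)) : ℂ) ∂μ := by
  obtain ⟨φ, hφ⟩ := exists_schwartzMap_eq_gaussDensity hb x
  have hφ' : (φ : EuclideanSpace ℝ (Fin d) → ℂ) = fun y => (gaussDensity b (y - x) : ℂ) :=
    funext hφ
  have h1 := h.fourier_eq φ
  rw [hφ'] at h1
  simp_rw [fourierInt_gaussDensity_sub hb] at h1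
  rw [← h1, ← integral_complex_ofReal]
  congr with y
  push_cast; rfl

lemma IsKernelWithSpectralMeasure.lintegral_mul_gaussDensity (h : IsKernelWithSpectralMeasure f μ)
    {b : ℝ} (hb : 0 < b) (x : EuclideanSpace ℝ (Fin d)) :
    ∫⁻ y, f y * ENNReal.ofReal (gaussDensity b (y - x))
      = ENNReal.ofReal (∫ y, (f y).toReal * gaussDensity b (y - x)) := by
  obtain ⟨φ, hφ⟩ := exists_schwartzMap_eq_gaussDensity hb x
  rw [ofReal_integral_eq_lintegral_ofReal]
  · refine lintegral_congr_ae ?_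
    filter_upwards [h.ae_lt_top] with y hy
    rw [ENNReal.ofReal_mul ENNReal.toReal_nonneg, ENNReal.ofReal_toReal hy.ne]
  · refine (h.integrable_mul φ).re.congr (.of_forall fun y => ?_)
    simp only [hφ, RCLike.re_to_complex, ← Complex.ofReal_mul, Complex.ofReal_re]
  · exact .of_forall fun y => mul_nonneg ENNReal.toReal_nonneg (gaussDensity_nonneg hb _)

/-- Supplies the integrable majorant for removing the mollifier by dominated convergence. -/
lemma IsKernelWithSpectralMeasure.lintegral_exp_neg_mul_sq_lt_top
    (h : IsKernelWithSpectralMeasure f μ) {b : ℝ} (hb : 0 < b) :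
    ∫⁻ y, f y * ENNReal.ofReal (Real.exp (-b * ‖y‖ ^ 2)) < ∞ := by
  have h1 : ∀ y : EuclideanSpace ℝ (Fin d), Real.exp (-b * ‖y‖ ^ 2)
      = ((b / Real.pi) ^ (Module.finrank ℝ (EuclideanSpace ℝ (Fin d)) / 2 : ℝ))⁻¹
        * gaussDensity b (y - 0) := by
    intro y
    rw [sub_zero, gaussDensity, ← mul_assoc, inv_mul_cancel₀ (by positivity), one_mul]
  simp_rw [h1, ENNReal.ofReal_mul (inv_nonneg.2 (Real.rpow_nonneg (div_pos hb Real.pi_pos).le _)),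
    mul_left_comm (f _)]
  rw [lintegral_const_mul' _ _ ENNReal.ofReal_ne_top, h.lintegral_mul_gaussDensity hb]
  exact ENNReal.mul_lt_top ENNReal.ofReal_lt_top ENNReal.ofReal_lt_top

/-- Parseval's identity for a kernel and a mollified density with non-negative Fourier
transform. -/
lemma IsKernelWithSpectralMeasure.lintegral_mul_mollified [SFinite μ]
    (h : IsKernelWithSpectralMeasure f μ) {φ : EuclideanSpace ℝ (Fin d) → ℝ}
    (hφ0 : ∀ x, 0 ≤ φ x) (hφi : Integrable φ) (hφm : Measurable φ)
    {w : EuclideanSpace ℝ (Fin d) → ℝ} (hw0 : ∀ ξ, 0 ≤ w ξ)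
    (hw : ∀ ξ, fourierInt (fun x => (φ x : ℂ)) ξ = (w ξ : ℂ)) {b : ℝ} (hb : 0 < b) :
    ∫⁻ y, f y * ∫⁻ x, ENNReal.ofReal (φ x * gaussDensity b (y - x))
      = ∫⁻ ξ, ENNReal.ofReal (w ξ * Real.exp (-‖ξ‖ ^ 2 / (4 * b))) ∂μ := by
  have hf := h.measurable
  have hg := (continuous_gaussDensity (V := EuclideanSpace ℝ (Fin d)) b).measurable
  have hG := integrable_exp_neg_sq_of_hasTemperateGrowth h.tempered hb
  -- The Gaussian damping of μ provides the absolute integrability needed for Fubini; without it `w`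
  -- need not be μ-integrable.
  have hint : Integrable (fun p : EuclideanSpace ℝ (Fin d) × EuclideanSpace ℝ (Fin d) =>
      Complex.exp (-Complex.I * ((inner ℝ p.2 p.1 : ℝ) : ℂ)) *
        ((φ p.1 : ℂ) * (Real.exp (-‖p.2‖ ^ 2 / (4 * b)) : ℂ))) (volume.prod μ) := by
    refine (hφi.ofReal (𝕜 := ℂ)).mul_prod hG.ofReal |>.bdd_mul (c := 1) ?_ ?_
    · exact Continuous.aestronglyMeasurable (by fun_prop)
    · exact .of_forall fun p => (norm_cexp_neg_I_mul_ofReal _).le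
  set F : EuclideanSpace ℝ (Fin d) → ℝ := fun x => ∫ y, (f y).toReal * gaussDensity b (y - x)
  have hF0 : ∀ x, 0 ≤ F x := fun x => integral_nonneg fun y =>
    mul_nonneg ENNReal.toReal_nonneg (gaussDensity_nonneg hb _)
  have hFφ : ∀ x, ∫ ξ, Complex.exp (-Complex.I * ((inner ℝ ξ x : ℝ) : ℂ)) *
        ((φ x : ℂ) * (Real.exp (-‖ξ‖ ^ 2 / (4 * b)) : ℂ)) ∂μ = ((φ x * F x : ℝ) : ℂ) := by
    intro x
    rw [Complex.ofReal_mul, h.integral_mul_gaussDensity hb, ← integral_const_mul]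
    congr with ξ; ring
  have hwξ : ∀ ξ, ∫ x, Complex.exp (-Complex.I * ((inner ℝ ξ x : ℝ) : ℂ)) *
        ((φ x : ℂ) * (Real.exp (-‖ξ‖ ^ 2 / (4 * b)) : ℂ))
        = ((w ξ * Real.exp (-‖ξ‖ ^ 2 / (4 * b)) : ℝ) : ℂ) := by
    intro ξ
    rw [Complex.ofReal_mul, ← hw, fourierInt, ← integral_mul_const]
    congr with x; ring
  have i1 : Integrable (fun x => φ x * F x) := by
    have := hint.integral_prod_left
    simp only [hFφ] at this
    simpa only [RCLike.re_to_complex, Complex.ofReal_re] using this.re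
  have i2 : Integrable (fun ξ => w ξ * Real.exp (-‖ξ‖ ^ 2 / (4 * b))) μ := by
    have := hint.integral_prod_right
    simp only [hwξ] at this
    simpa only [RCLike.re_to_complex, Complex.ofReal_re] using this.re
  have key : ∫ x, φ x * F x = ∫ ξ, w ξ * Real.exp (-‖ξ‖ ^ 2 / (4 * b)) ∂μ := by
    have := integral_integral_swap (f := fun x ξ => Complex.exp (-Complex.I *
      ((inner ℝ ξ x : ℝ) : ℂ)) * ((φ x : ℂ) * (Real.exp (-‖ξ‖ ^ 2 / (4 * b)) : ℂ))) hint
    simp only [hFφ, hwξ, integral_complex_ofReal] at this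
    exact_mod_cast this
  rw [← ofReal_integral_eq_lintegral_ofReal i2 (.of_forall fun ξ => mul_nonneg (hw0 ξ)
    (Real.exp_nonneg _)), ← key, ofReal_integral_eq_lintegral_ofReal i1
    (.of_forall fun x => mul_nonneg (hφ0 x) (hF0 x))]
  calc ∫⁻ y, f y * ∫⁻ x, ENNReal.ofReal (φ x * gaussDensity b (y - x))
      = ∫⁻ y, ∫⁻ x, f y * ENNReal.ofReal (φ x * gaussDensity b (y - x)) := by
        refine lintegral_congr fun y => ?_
        rw [lintegral_const_mul _ (by fun_prop)]
    _ = ∫⁻ x, ∫⁻ y, f y * ENNReal.ofReal (φ x * gaussDensity b (y - x)) := by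
        rw [lintegral_lintegral_swap]
        exact Measurable.aemeasurable (by fun_prop)
    _ = _ := by
        refine lintegral_congr fun x => ?_
        simp_rw [ENNReal.ofReal_mul (hφ0 x), mul_left_comm (f _)]
        rw [lintegral_const_mul' _ _ ENNReal.ofReal_ne_top, h.lintegral_mul_gaussDensity hb]

end Kernel

/-! ### Parseval's identity with values in [0, ∞]. -/

section Parseval

variable {d : ℕ} {f : EuclideanSpace ℝ (Fin d) → ℝ≥0∞} {μ : Measure (EuclideanSpace ℝ (Fin d))}

lemma continuous_fourierInt {φ : EuclideanSpace ℝ (Fin d) → ℂ} (hφ : Integrable φ) :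
    Continuous (fourierInt φ) := by
  unfold fourierInt
  refine continuous_of_dominated (bound := fun x => ‖φ x‖) (fun ξ => ?_) (fun ξ => ?_) hφ.norm ?_
  · exact (Continuous.aestronglyMeasurable (by fun_prop)).mul hφ.aestronglyMeasurable
  · exact .of_forall fun x => by rw [norm_mul, norm_cexp_neg_I_mul_ofReal, one_mul]
  · exact .of_forall fun x => by fun_prop

lemma continuous_of_fourierInt_eq_ofReal {φ : EuclideanSpace ℝ (Fin d) → ℂ} (hφ : Integrable φ)
    {w : EuclideanSpace ℝ (Fin d) → ℝ} (hw : ∀ ξ, fourierInt φ ξ = (w ξ : ℂ)) : Continuous w := by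
  have : w = fun ξ => (fourierInt φ ξ).re := by ext ξ; simp [hw]
  rw [this]
  exact Complex.continuous_re.comp (continuous_fourierInt hφ)

lemma tendsto_natCast_add_one_atTop : Tendsto (fun n : ℕ => (n : ℝ) + 1) atTop atTop :=
  tendsto_atTop_add_const_right _ _ tendsto_natCast_atTop_atTop

lemma tendsto_exp_neg_div_four_mul (c : ℝ) :
    Tendsto (fun n : ℕ => Real.exp (-c / (4 * ((n : ℝ) + 1)))) atTop (𝓝 1) := by
  have h1 : Tendsto (fun n : ℕ => -c / (4 * ((n : ℝ) + 1))) atTop (𝓝 0) :=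
    tendsto_const_nhds.div_atTop (tendsto_natCast_add_one_atTop.const_mul_atTop (by norm_num))
  simpa [Function.comp_def] using (Real.continuous_exp.tendsto _).comp h1

lemma exp_neg_sq_div_le_one (x : EuclideanSpace ℝ (Fin d)) (n : ℕ) :
    Real.exp (-‖x‖ ^ 2 / (4 * ((n : ℝ) + 1))) ≤ 1 := by
  rw [Real.exp_le_one_iff]
  exact div_nonpos_of_nonpos_of_nonneg (neg_nonpos.2 (sq_nonneg _)) (by positivity)

lemma measurable_lintegral_mul_gaussDensity {φ : EuclideanSpace ℝ (Fin d) → ℝ}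
    (hφ : Measurable φ) (b : ℝ) :
    Measurable fun y => ∫⁻ x, ENNReal.ofReal (φ x * gaussDensity b (y - x)) := by
  have hg := (continuous_gaussDensity (V := EuclideanSpace ℝ (Fin d)) b).measurable
  have : Measurable fun p : EuclideanSpace ℝ (Fin d) × EuclideanSpace ℝ (Fin d) =>
      ENNReal.ofReal (φ p.2 * gaussDensity b (p.1 - p.2)) := by fun_prop
  exact this.lintegral_prod_right

/-- Fatou on the side of `f` as the mollifier shrinks; on the side of `μ` the damping factor is at
most 1 and `w ≥ 0`. -/
lemma IsKernelWithSpectralMeasure.lintegral_mul_le_lintegral_fourier [SFinite μ]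
    (h : IsKernelWithSpectralMeasure f μ) {φ : EuclideanSpace ℝ (Fin d) → ℝ}
    (hφc : Continuous φ) (hφ0 : ∀ x, 0 ≤ φ x) (hφi : Integrable φ) (hφb : ∃ M, ∀ x, φ x ≤ M)
    {w : EuclideanSpace ℝ (Fin d) → ℝ} (hw0 : ∀ ξ, 0 ≤ w ξ)
    (hw : ∀ ξ, fourierInt (fun x => (φ x : ℂ)) ξ = (w ξ : ℂ)) :
    ∫⁻ y, f y * ENNReal.ofReal (φ y) ≤ ∫⁻ ξ, ENNReal.ofReal (w ξ) ∂μ := by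
  have hf := h.measurable
  have hφm := hφc.measurable
  calc ∫⁻ y, f y * ENNReal.ofReal (φ y)
      = ∫⁻ y, liminf (fun n : ℕ =>
          f y * ∫⁻ x, ENNReal.ofReal (φ x * gaussDensity ((n : ℝ) + 1) (y - x))) atTop := by
        refine lintegral_congr_ae ?_
        filter_upwards [h.ae_lt_top] with y hy
        refine (Tendsto.liminf_eq (ENNReal.Tendsto.const_mul ?_ (.inr hy.ne))).symm
        exact (tendsto_lintegral_mul_gaussDensity hφc hφ0 hφi hφb y).comp
          tendsto_natCast_add_one_atTop
    _ ≤ liminf (fun n : ℕ => ∫⁻ y,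
          f y * ∫⁻ x, ENNReal.ofReal (φ x * gaussDensity ((n : ℝ) + 1) (y - x))) atTop := by
        exact lintegral_liminf_le fun n => hf.mul (measurable_lintegral_mul_gaussDensity hφm _)
    _ ≤ liminf (fun _ : ℕ => ∫⁻ ξ, ENNReal.ofReal (w ξ) ∂μ) atTop := by
        refine liminf_le_liminf (.of_forall fun n => ?_)
        rw [h.lintegral_mul_mollified hφ0 hφi hφm hw0 hw (by positivity)]
        refine lintegral_mono fun ξ => ENNReal.ofReal_le_ofReal ?_
        exact mul_le_of_le_one_right (hw0 ξ) (exp_neg_sq_div_le_one ξ n)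
    _ = _ := liminf_const _

/-- The roles are exchanged: Gaussian decay of `φ` allows dominated convergence on the side of `f`,
and Fatou is applied on the side of `μ`. -/
lemma IsKernelWithSpectralMeasure.lintegral_fourier_le_of_gaussian_decay [SFinite μ]
    (h : IsKernelWithSpectralMeasure f μ) {φ : EuclideanSpace ℝ (Fin d) → ℝ}
    (hφc : Continuous φ) (hφ0 : ∀ x, 0 ≤ φ x) (hφi : Integrable φ) {M a : ℝ} (ha : 0 < a)
    (hM : 0 ≤ M) (hφb : ∀ x, φ x ≤ M * Real.exp (-a * ‖x‖ ^ 2))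
    {w : EuclideanSpace ℝ (Fin d) → ℝ} (hw0 : ∀ ξ, 0 ≤ w ξ)
    (hw : ∀ ξ, fourierInt (fun x => (φ x : ℂ)) ξ = (w ξ : ℂ)) :
    ∫⁻ ξ, ENNReal.ofReal (w ξ) ∂μ ≤ ∫⁻ y, f y * ENNReal.ofReal (φ y) := by
  have hf := h.measurable
  have hφm := hφc.measurable
  have hwc : Continuous w := continuous_of_fourierInt_eq_ofReal hφi.ofReal hw
  have hbdd : ∃ M, ∀ x, φ x ≤ M := ⟨M, fun x => (hφb x).trans (mul_le_of_le_one_right hM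
    (Real.exp_le_one_iff.2 (by nlinarith [sq_nonneg ‖x‖])))⟩
  have hlim : Tendsto (fun n : ℕ => ∫⁻ y,
      f y * ∫⁻ x, ENNReal.ofReal (φ x * gaussDensity ((n : ℝ) + 1) (y - x))) atTop
      (𝓝 (∫⁻ y, f y * ENNReal.ofReal (φ y))) := by
    refine tendsto_lintegral_filter_of_dominated_convergence (fun y => f y * ENNReal.ofReal
      (M * 2 ^ (Module.finrank ℝ (EuclideanSpace ℝ (Fin d)) / 2 : ℝ)
        * Real.exp (-(a / 2) * ‖y‖ ^ 2))) ?_ ?_ ?_ ?_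
    · exact .of_forall fun n => hf.mul (measurable_lintegral_mul_gaussDensity hφm _)
    · filter_upwards [tendsto_natCast_add_one_atTop.eventually_ge_atTop (2 * a)] with n hn
      refine .of_forall fun y => ?_
      gcongr
      exact lintegral_mul_gaussDensity_le ha hn hM hφb y
    · simp_rw [ENNReal.ofReal_mul (show 0 ≤ M * 2 ^ (Module.finrank ℝ
        (EuclideanSpace ℝ (Fin d)) / 2 : ℝ) by positivity), mul_left_comm (f _)]
      rw [lintegral_const_mul' _ _ ENNReal.ofReal_ne_top]
      exact (ENNReal.mul_lt_top ENNReal.ofReal_lt_top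
        (h.lintegral_exp_neg_mul_sq_lt_top (half_pos ha))).ne
    · filter_upwards [h.ae_lt_top] with y hy
      refine ENNReal.Tendsto.const_mul ?_ (.inr hy.ne)
      exact (tendsto_lintegral_mul_gaussDensity hφc hφ0 hφi hbdd y).comp
        tendsto_natCast_add_one_atTop
  calc ∫⁻ ξ, ENNReal.ofReal (w ξ) ∂μ
      = ∫⁻ ξ, liminf (fun n : ℕ =>
          ENNReal.ofReal (w ξ * Real.exp (-‖ξ‖ ^ 2 / (4 * ((n : ℝ) + 1))))) atTop ∂μ := by
        refine lintegral_congr fun ξ => (Tendsto.liminf_eq (ENNReal.tendsto_ofReal ?_)).symm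
        simpa using (tendsto_exp_neg_div_four_mul (‖ξ‖ ^ 2)).const_mul (w ξ)
    _ ≤ liminf (fun n : ℕ => ∫⁻ ξ,
          ENNReal.ofReal (w ξ * Real.exp (-‖ξ‖ ^ 2 / (4 * ((n : ℝ) + 1)))) ∂μ) atTop :=
        lintegral_liminf_le fun n => by fun_prop
    _ = _ := by
        rw [← hlim.liminf_eq]
        congr with n
        rw [h.lintegral_mul_mollified hφ0 hφi hφm hw0 hw (by positivity)]

/-- Multiplying by a Gaussian replaces the Fourier transform by a Gaussian average of its
translates. -/
lemma fourierInt_mul_exp_neg_sq {φ : EuclideanSpace ℝ (Fin d) → ℝ} (hφi : Integrable φ)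
    {w : EuclideanSpace ℝ (Fin d) → ℝ}
    (hw : ∀ ξ, fourierInt (fun x => (φ x : ℂ)) ξ = (w ξ : ℂ)) {b : ℝ} (hb : 0 < b)
    (ξ : EuclideanSpace ℝ (Fin d)) :
    fourierInt (fun x => ((φ x * Real.exp (-‖x‖ ^ 2 / (4 * b)) : ℝ) : ℂ)) ξ
      = ((∫ η, w (ξ + η) * gaussDensity b η : ℝ) : ℂ) := by
  -- The Gaussian factor is itself the Fourier transform of `gaussDensity b`; inserting this
  -- integral and swapping gives the average.
  set K : EuclideanSpace ℝ (Fin d) → EuclideanSpace ℝ (Fin d) → ℂ := fun x η =>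
    Complex.exp (-Complex.I * ((inner ℝ (ξ + η) x : ℝ) : ℂ)) *
      ((φ x : ℂ) * (gaussDensity b η : ℂ)) with hK
  have hint : Integrable (Function.uncurry K) (volume.prod volume) := by
    refine (hφi.ofReal (𝕜 := ℂ)).mul_prod (integrable_gaussDensity hb).ofReal
      |>.bdd_mul (c := 1) ?_ ?_
    · exact Continuous.aestronglyMeasurable (by fun_prop)
    · exact .of_forall fun p => (norm_cexp_neg_I_mul_ofReal _).le
  have h1 : ∀ x, ∫ η, K x η = Complex.exp (-Complex.I * ((inner ℝ ξ x : ℝ) : ℂ)) *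
      ((φ x * Real.exp (-‖x‖ ^ 2 / (4 * b)) : ℝ) : ℂ) := by
    intro x
    rw [Complex.ofReal_mul, ← integral_cexp_inner_mul_gaussDensity hb, ← mul_assoc,
      ← integral_const_mul]
    congr with η
    rw [hK]
    simp only [inner_add_left, real_inner_comm x η, Complex.ofReal_add, mul_add, Complex.exp_add]
    ring
  have h2 : ∀ η, ∫ x, K x η = ((w (ξ + η) * gaussDensity b η : ℝ) : ℂ) := by
    intro η
    rw [Complex.ofReal_mul, ← hw, fourierInt, ← integral_mul_const]
    congr with x
    rw [hK]; ring
  rw [fourierInt, ← integral_complex_ofReal]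
  simp_rw [← h1, ← h2]
  exact integral_integral_swap hint

/-- Parseval's identity in `[0, ∞]` for a kernel and a bounded continuous density with
non-negative Fourier transform. -/
theorem IsKernelWithSpectralMeasure.lintegral_mul_eq_lintegral_fourier [SFinite μ]
    (h : IsKernelWithSpectralMeasure f μ) {φ : EuclideanSpace ℝ (Fin d) → ℝ}
    (hφc : Continuous φ) (hφ0 : ∀ x, 0 ≤ φ x) (hφi : Integrable φ) (hφb : ∃ M, ∀ x, φ x ≤ M)
    {w : EuclideanSpace ℝ (Fin d) → ℝ} (hw0 : ∀ ξ, 0 ≤ w ξ)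
    (hw : ∀ ξ, fourierInt (fun x => (φ x : ℂ)) ξ = (w ξ : ℂ)) :
    ∫⁻ y, f y * ENNReal.ofReal (φ y) = ∫⁻ ξ, ENNReal.ofReal (w ξ) ∂μ := by
  refine le_antisymm (h.lintegral_mul_le_lintegral_fourier hφc hφ0 hφi hφb hw0 hw) ?_
  obtain ⟨M, hM⟩ := hφb
  have hM0 : 0 ≤ M := (hφ0 0).trans (hM 0)
  -- Truncation by wide Gaussians: `φ' n ≤ φ` has Gaussian decay, and its transform `w' n`, an
  -- average of `w`, is still non-negative.
  set φ' : ℕ → EuclideanSpace ℝ (Fin d) → ℝ := fun n x =>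
    φ x * Real.exp (-‖x‖ ^ 2 / (4 * ((n : ℝ) + 1))) with hφ'
  set w' : ℕ → EuclideanSpace ℝ (Fin d) → ℝ := fun n ξ =>
    ∫ η, w (ξ + η) * gaussDensity ((n : ℝ) + 1) η with hw'
  have hle : ∀ n x, φ' n x ≤ φ x := fun n x =>
    mul_le_of_le_one_right (hφ0 x) (exp_neg_sq_div_le_one x n)
  have hφ'0 : ∀ n x, 0 ≤ φ' n x := fun n x => mul_nonneg (hφ0 x) (Real.exp_nonneg _)
  have hφ'c : ∀ n, Continuous (φ' n) := fun n => by fun_prop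
  have hφ'i : ∀ n, Integrable (φ' n) := fun n =>
    hφi.mono' (hφ'c n).aestronglyMeasurable (.of_forall fun x => by
      rw [Real.norm_of_nonneg (hφ'0 n x)]; exact hle n x)
  have hw'0 : ∀ n ξ, 0 ≤ w' n ξ := fun n ξ => integral_nonneg fun η =>
    mul_nonneg (hw0 _) (gaussDensity_nonneg (by positivity) _)
  have hw'f : ∀ n ξ, fourierInt (fun x => (φ' n x : ℂ)) ξ = (w' n ξ : ℂ) := fun n ξ =>
    fourierInt_mul_exp_neg_sq hφi hw (by positivity) ξ
  have hw'c : ∀ n, Continuous (w' n) := fun n =>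
    continuous_of_fourierInt_eq_ofReal (hφ'i n).ofReal (hw'f n)
  -- Convergence is read off from the Fourier integrals of `φ' n`, dominated by the integrable `φ`.
  have hlim : ∀ ξ, Tendsto (fun n => w' n ξ) atTop (𝓝 (w ξ)) := by
    intro ξ
    have h1 : Tendsto (fun n => fourierInt (fun x => (φ' n x : ℂ)) ξ) atTop
        (𝓝 (fourierInt (fun x => (φ x : ℂ)) ξ)) := by
      refine tendsto_integral_of_dominated_convergence φ (fun n => ?_) hφi (fun n => ?_) ?_
      · exact Continuous.aestronglyMeasurable (by fun_prop)
      · refine .of_forall fun x => ?_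
        rw [norm_mul, norm_cexp_neg_I_mul_ofReal, one_mul, Complex.norm_real,
          Real.norm_of_nonneg (hφ'0 n x)]
        exact hle n x
      · refine .of_forall fun x => Tendsto.const_mul _ ?_
        refine (Complex.continuous_ofReal.tendsto _).comp ?_
        simpa using (tendsto_exp_neg_div_four_mul (‖x‖ ^ 2)).const_mul (φ x)
    simp only [hw'f, hw] at h1
    simpa [Function.comp_def] using (Complex.continuous_re.tendsto _).comp h1
  calc ∫⁻ ξ, ENNReal.ofReal (w ξ) ∂μ
      = ∫⁻ ξ, liminf (fun n => ENNReal.ofReal (w' n ξ)) atTop ∂μ :=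
        lintegral_congr fun ξ => (ENNReal.tendsto_ofReal (hlim ξ)).liminf_eq.symm
    _ ≤ liminf (fun n => ∫⁻ ξ, ENNReal.ofReal (w' n ξ) ∂μ) atTop :=
        lintegral_liminf_le fun n => (hw'c n).measurable.ennreal_ofReal
    _ ≤ liminf (fun _ : ℕ => ∫⁻ y, f y * ENNReal.ofReal (φ y)) atTop := by
        refine liminf_le_liminf (.of_forall fun n => ?_)
        refine (h.lintegral_fourier_le_of_gaussian_decay (hφ'c n) (hφ'0 n) (hφ'i n)
          (a := 1 / (4 * ((n : ℝ) + 1))) (by positivity) hM0 (fun x => ?_) (hw'0 n)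
          (hw'f n)).trans ?_
        · have : -(1 / (4 * ((n : ℝ) + 1))) * ‖x‖ ^ 2 = -‖x‖ ^ 2 / (4 * ((n : ℝ) + 1)) := by ring
          rw [this]
          exact mul_le_mul_of_nonneg_right (hM x) (Real.exp_nonneg _)
        · refine lintegral_mono fun y => ?_
          gcongr
          exact hle n y
    _ = _ := liminf_const _

end Parseval

/-! ### Density and characteristic function of the symmetrization. -/

section Symmetrization

variable {d : ℕ}

/-- The density of `Y - Z` when `Y` and `Z` are independent with density `q`. -/
def autocorrelation (q : EuclideanSpace ℝ (Fin d) → ℝ) (x : EuclideanSpace ℝ (Fin d)) : ℝ :=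
  ∫ z, q (z + x) * q z

section Autocorrelation

variable {q : EuclideanSpace ℝ (Fin d) → ℝ}

lemma memLp_two_comp_add_right (hq : MemLp q 2) (x : EuclideanSpace ℝ (Fin d)) :
    MemLp (fun z => q (z + x)) 2 :=
  hq.comp_measurePreserving (measurePreserving_add_right volume x)

lemma integrable_mul_translate (hq : MemLp q 2) (x : EuclideanSpace ℝ (Fin d)) :
    Integrable (fun z => q (z + x) * q z) :=
  (memLp_two_comp_add_right hq x).integrable_mul hq

lemma autocorrelation_nonneg (hq0 : ∀ x, 0 ≤ q x) (x : EuclideanSpace ℝ (Fin d)) :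
    0 ≤ autocorrelation q x :=
  integral_nonneg fun _ => mul_nonneg (hq0 _) (hq0 _)

lemma autocorrelation_eq_inner (hq : MemLp q 2) (x : EuclideanSpace ℝ (Fin d)) :
    autocorrelation q x = inner ℝ ((memLp_two_comp_add_right hq x).toLp _) (hq.toLp q) := by
  rw [L2.inner_def, autocorrelation]
  refine integral_congr_ae ?_
  filter_upwards [(memLp_two_comp_add_right hq x).coeFn_toLp, hq.coeFn_toLp] with z h1 h2
  rw [h1, h2]
  simp [mul_comm]

/-- The autocorrelation is the L² inner product of `q` with its translate, and translation is
continuous in L². -/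
lemma continuous_autocorrelation (hq : MemLp q 2) : Continuous (autocorrelation q) := by
  let g : C(EuclideanSpace ℝ (Fin d), C(EuclideanSpace ℝ (Fin d), EuclideanSpace ℝ (Fin d))) :=
    (ContinuousMap.mk (fun p : EuclideanSpace ℝ (Fin d) × EuclideanSpace ℝ (Fin d) =>
      p.2 + p.1) (by fun_prop)).curry
  have hg : ∀ x, MeasurePreserving (g x) volume volume := fun x =>
    measurePreserving_add_right volume x
  have h1 : Continuous fun x => Lp.compMeasurePreserving (g x) (hg x) (hq.toLp q) :=
    (continuous_const (y := hq.toLp q)).compMeasurePreservingLp g.continuous hg (by norm_num)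
  have h2 : autocorrelation q = fun x =>
      inner ℝ (Lp.compMeasurePreserving (g x) (hg x) (hq.toLp q)) (hq.toLp q) := by
    ext x
    rw [autocorrelation_eq_inner hq]
    rfl
  rw [h2]
  exact h1.inner continuous_const

lemma exists_bound_autocorrelation (hq : MemLp q 2) : ∃ M, ∀ x, autocorrelation q x ≤ M := by
  refine ⟨‖hq.toLp q‖ * ‖hq.toLp q‖, fun x => ?_⟩
  rw [autocorrelation_eq_inner hq]
  refine (real_inner_le_norm _ _).trans_eq ?_
  congr 1
  exact Lp.norm_compMeasurePreserving (hq.toLp q) (measurePreserving_add_right volume x)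

lemma ofReal_autocorrelation (hq : MemLp q 2) (hq0 : ∀ x, 0 ≤ q x)
    (x : EuclideanSpace ℝ (Fin d)) :
    ENNReal.ofReal (autocorrelation q x)
      = ∫⁻ z, ENNReal.ofReal (q (z + x)) * ENNReal.ofReal (q z) := by
  rw [autocorrelation, ofReal_integral_eq_lintegral_ofReal (integrable_mul_translate hq x)
    (.of_forall fun z => mul_nonneg (hq0 _) (hq0 _))]
  exact lintegral_congr fun z => ENNReal.ofReal_mul (hq0 _)

/-- Substitute y = z + x in the inner integral, then apply Tonelli. -/
lemma lintegral_lintegral_sub_eq_lintegral_autocorrelation (hqm : Measurable q) (hq : MemLp q 2)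
    (hq0 : ∀ x, 0 ≤ q x) {φ : EuclideanSpace ℝ (Fin d) → ℝ≥0∞} (hφ : Measurable φ) :
    ∫⁻ z, ENNReal.ofReal (q z) * ∫⁻ y, ENNReal.ofReal (q y) * φ (y - z)
      = ∫⁻ x, φ x * ENNReal.ofReal (autocorrelation q x) := by
  calc ∫⁻ z, ENNReal.ofReal (q z) * ∫⁻ y, ENNReal.ofReal (q y) * φ (y - z)
      = ∫⁻ z, ∫⁻ x, φ x * (ENNReal.ofReal (q (z + x)) * ENNReal.ofReal (q z)) := by
        refine lintegral_congr fun z => ?_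
        rw [← lintegral_add_left_eq_self _ z, ← lintegral_const_mul _ (by fun_prop)]
        refine lintegral_congr fun x => ?_
        rw [add_sub_cancel_left]; ring
    _ = ∫⁻ x, ∫⁻ z, φ x * (ENNReal.ofReal (q (z + x)) * ENNReal.ofReal (q z)) :=
        lintegral_lintegral_swap (Measurable.aemeasurable (by fun_prop))
    _ = _ := by
        refine lintegral_congr fun x => ?_
        rw [lintegral_const_mul _ (by fun_prop), ofReal_autocorrelation hq hq0]

end Autocorrelation

variable {Ω : Type*} [MeasurableSpace Ω] {P : Measure Ω} [IsProbabilityMeasure P]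
  {X : ℝ≥0 → Ω → EuclideanSpace ℝ (Fin d)} {Ψ : EuclideanSpace ℝ (Fin d) → ℂ}

lemma lintegral_symmetrization {t : ℝ≥0} (hXm : Measurable (X t))
    {q : EuclideanSpace ℝ (Fin d) → ℝ} (hqm : Measurable q) (hq0 : ∀ x, 0 ≤ q x)
    (hlaw : P.map (X t) = volume.withDensity fun x => ENNReal.ofReal (q x)) (hq : MemLp q 2)
    {φ : EuclideanSpace ℝ (Fin d) → ℝ≥0∞} (hφ : Measurable φ) :
    ∫⁻ ω, φ (symmetrization X t ω) ∂(P.prod P)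
      = ∫⁻ x, φ x * ENNReal.ofReal (autocorrelation q x) := by
  have h1 : ∀ ψ : EuclideanSpace ℝ (Fin d) → ℝ≥0∞, Measurable ψ →
      ∫⁻ ω, ψ (X t ω) ∂P = ∫⁻ x, ENNReal.ofReal (q x) * ψ x := by
    intro ψ hψ
    rw [← lintegral_map hψ hXm, hlaw, lintegral_withDensity_eq_lintegral_mul _ (by fun_prop) hψ]
    rfl
  rw [lintegral_prod_symm _ (Measurable.aemeasurable (by unfold symmetrization; fun_prop)),
    ← lintegral_lintegral_sub_eq_lintegral_autocorrelation hqm hq hq0 hφ]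
  simp only [symmetrization]
  have h2 : ∀ z, ∫⁻ ω, φ (X t ω - z) ∂P = ∫⁻ y, ENNReal.ofReal (q y) * φ (y - z) := fun z =>
    h1 (fun y => φ (y - z)) (by fun_prop)
  simp_rw [h2]
  refine h1 (fun z => ∫⁻ y, ENNReal.ofReal (q y) * φ (y - z)) ?_
  have : Measurable fun p : EuclideanSpace ℝ (Fin d) × EuclideanSpace ℝ (Fin d) =>
      ENNReal.ofReal (q p.2) * φ (p.2 - p.1) := by fun_prop
  exact this.lintegral_prod_right

lemma map_symmetrization {t : ℝ≥0} (hXm : Measurable (X t))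
    {q : EuclideanSpace ℝ (Fin d) → ℝ} (hqm : Measurable q) (hq0 : ∀ x, 0 ≤ q x)
    (hlaw : P.map (X t) = volume.withDensity fun x => ENNReal.ofReal (q x)) (hq : MemLp q 2) :
    (P.prod P).map (symmetrization X t)
      = volume.withDensity fun x => ENNReal.ofReal (autocorrelation q x) := by
  have hm : Measurable (symmetrization X t) := by unfold symmetrization; fun_prop
  ext A hA
  rw [← lintegral_indicator_one hA, lintegral_map (measurable_one.indicator hA) hm,
    lintegral_symmetrization hXm hqm hq0 hlaw hq (measurable_one.indicator hA),
    withDensity_apply _ hA, ← lintegral_indicator hA]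
  refine lintegral_congr fun x => ?_
  by_cases hx : x ∈ A <;> simp [hx]

/-- By independence the characteristic function is that of `X t` times its conjugate, so the
imaginary part of Ψ cancels. -/
lemma integral_cexp_symmetrization (hΨ : IsCharExponent X P Ψ) {t : ℝ≥0} (ht : 0 < t)
    (ξ : EuclideanSpace ℝ (Fin d)) :
    ∫ ω, Complex.exp (-Complex.I * ((inner ℝ ξ (symmetrization X t ω) : ℝ) : ℂ)) ∂(P.prod P)
      = (Real.exp (-(2 * t * (Ψ ξ).re)) : ℂ) := by
  have h1 : ∀ ω : Ω × Ω,
      Complex.exp (-Complex.I * ((inner ℝ ξ (symmetrization X t ω) : ℝ) : ℂ))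
      = Complex.exp (-Complex.I * ((inner ℝ ξ (X t ω.1) : ℝ) : ℂ)) *
        (starRingEnd ℂ) (Complex.exp (-Complex.I * ((inner ℝ ξ (X t ω.2) : ℝ) : ℂ))) := by
    intro ω
    rw [← Complex.exp_conj, ← Complex.exp_add, symmetrization, inner_sub_right]
    congr 1
    simp
    ring
  simp_rw [h1]
  rw [integral_prod_mul (fun ω => Complex.exp (-Complex.I * ((inner ℝ ξ (X t ω) : ℝ) : ℂ)))
    (fun ω => (starRingEnd ℂ) (Complex.exp (-Complex.I * ((inner ℝ ξ (X t ω) : ℝ) : ℂ)))),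
    integral_conj, hΨ t ht ξ, ← Complex.exp_conj, ← Complex.exp_add]
  push_cast
  congr 1
  apply Complex.ext
  · simp; ring
  · simp

/-- The law of the symmetrization at a positive time has a bounded continuous density. -/
lemma exists_density_symmetrization (hXm : ∀ t, Measurable (X t)) (hΨ : IsCharExponent X P Ψ)
    (hp : HasL2Densities X P) {t : ℝ≥0} (ht : 0 < t) :
    ∃ φ : EuclideanSpace ℝ (Fin d) → ℝ, Continuous φ ∧ (∀ x, 0 ≤ φ x) ∧ Integrable φ ∧
      (∃ M, ∀ x, φ x ≤ M) ∧
      (∀ ξ, fourierInt (fun x => (φ x : ℂ)) ξ = (Real.exp (-(2 * t * (Ψ ξ).re)) : ℂ)) ∧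
      ∀ ψ : EuclideanSpace ℝ (Fin d) → ℝ≥0∞, Measurable ψ →
        symmSemigroup X P t ψ 0 = ∫⁻ x, ψ x * ENNReal.ofReal (φ x) := by
  obtain ⟨q, hqm, hq0, hlaw, hq⟩ := hp t ht
  have hc := continuous_autocorrelation hq
  have h0 := autocorrelation_nonneg hq0
  have hmap := map_symmetrization (hXm t) hqm hq0 hlaw hq
  have hm : Measurable (symmetrization X t) := by
    have := hXm t
    unfold symmetrization; fun_prop
  refine ⟨autocorrelation q, hc, h0, ?_, exists_bound_autocorrelation hq, fun ξ => ?_,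
    fun ψ hψ => ?_⟩
  · refine ⟨hc.aestronglyMeasurable, ?_⟩
    rw [hasFiniteIntegral_iff_ofReal (.of_forall h0)]
    have := lintegral_symmetrization (hXm t) hqm hq0 hlaw hq measurable_one
    simp only [Pi.one_apply, one_mul, lintegral_one, measure_univ] at this
    rw [← this]
    exact ENNReal.one_lt_top
  · rw [← integral_cexp_symmetrization hΨ ht, ← integral_map (f := fun x =>
      Complex.exp (-Complex.I * ((inner ℝ ξ x : ℝ) : ℂ))) hm.aemeasurable
      (Continuous.aestronglyMeasurable (by fun_prop)), hmap,
      integral_withDensity_eq_integral_toReal_smul (by fun_prop)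
      (.of_forall fun x => ENNReal.ofReal_lt_top), fourierInt]
    refine integral_congr_ae (.of_forall fun x => ?_)
    simp only [ENNReal.toReal_ofReal (h0 x), Complex.real_smul, mul_comm]
  · simp only [symmSemigroup, semigroup, zero_add]
    exact lintegral_symmetrization (hXm t) hqm hq0 hlaw hq hψ

/-- A characteristic function has modulus at most 1; take t = 1. -/
lemma IsCharExponent.re_nonneg (hΨ : IsCharExponent X P Ψ) (ξ : EuclideanSpace ℝ (Fin d)) :
    0 ≤ (Ψ ξ).re := by
  have h1 := norm_integral_le_of_norm_le_const (μ := P) (C := 1) (.of_forall fun ω =>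
    (norm_cexp_neg_I_mul_ofReal (inner ℝ ξ (X 1 ω))).le)
  rw [hΨ 1 one_pos ξ, Complex.norm_exp] at h1
  simpa using h1

/-- At t = 1, exp(-2 Re Ψ) is the Fourier transform of an integrable density, hence continuous; take
logarithms. -/
lemma IsCharExponent.measurable_re (hΨ : IsCharExponent X P Ψ) (hXm : ∀ t, Measurable (X t))
    (hp : HasL2Densities X P) : Measurable fun ξ => (Ψ ξ).re := by
  obtain ⟨φ, -, -, hφi, -, hφ, -⟩ := exists_density_symmetrization hXm hΨ hp one_pos
  have h1 := (continuous_of_fourierInt_eq_ofReal hφi.ofReal hφ).measurable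
  have h2 : (fun ξ => (Ψ ξ).re)
      = fun ξ => -(Real.log (Real.exp (-(2 * (1 : ℝ≥0) * (Ψ ξ).re)))) / 2 := by
    ext ξ; rw [Real.log_exp]; simp
  rw [h2]
  fun_prop

/-- The symmetrized semigroup applied to a kernel, in terms of its spectral measure. -/
lemma symmSemigroup_zero_eq_lintegral {f : EuclideanSpace ℝ (Fin d) → ℝ≥0∞}
    {μ : Measure (EuclideanSpace ℝ (Fin d))} [SFinite μ] (hXm : ∀ t, Measurable (X t))
    (hΨ : IsCharExponent X P Ψ) (hp : HasL2Densities X P) (h : IsKernelWithSpectralMeasure f μ)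
    {t : ℝ≥0} (ht : 0 < t) :
    symmSemigroup X P t f 0 = ∫⁻ ξ, ENNReal.ofReal (Real.exp (-(2 * t * (Ψ ξ).re))) ∂μ := by
  obtain ⟨φ, hφc, hφ0, hφi, hφb, hφ, hφs⟩ := exists_density_symmetrization hXm hΨ hp ht
  rw [hφs f h.measurable, h.lintegral_mul_eq_lintegral_fourier hφc hφ0 hφi hφb
    (fun ξ => (Real.exp_nonneg _)) hφ]

end Symmetrization

/-! ### The Gamma integral over the quadrant and the resolvent formula. -/

section Resolvent

lemma lintegral_rpow_mul_exp_neg_mul_Ioi {a β : ℝ} (ha : 0 < a) (hβ : 0 < β) :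
    ∫⁻ t in Set.Ioi (0 : ℝ), ENNReal.ofReal (t ^ (a - 1) * Real.exp (-(β * t)))
      = ENNReal.ofReal ((1 / β) ^ a * Real.Gamma a) := by
  rw [← Real.integral_rpow_mul_exp_neg_mul_Ioi ha hβ, ofReal_integral_eq_lintegral_ofReal]
  · have := integrableOn_rpow_mul_exp_neg_mul_rpow (s := a - 1) (p := 1) (b := β) (by linarith)
      one_pos hβ
    simpa [IntegrableOn] using this
  · refine (ae_restrict_iff' measurableSet_Ioi).2 (.of_forall fun t ht => ?_)
    exact mul_nonneg (Real.rpow_nonneg (le_of_lt ht) _) (Real.exp_nonneg _)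

/-- With u = r - s one has r + s = u + 2s, so the integral factors into an exponential in s and a
Gamma integral in u. -/
lemma lintegral_Ioi_abs_sub_rpow_mul_exp {a β : ℝ} (ha : 0 < a) (hβ : 0 < β) (s : ℝ) :
    ∫⁻ r in Set.Ioi s, ENNReal.ofReal (|r - s| ^ (a - 1) * Real.exp (-(β * (r + s))))
      = ENNReal.ofReal (Real.exp (-(2 * β * s)))
        * ENNReal.ofReal ((1 / β) ^ a * Real.Gamma a) := by
  rw [← lintegral_rpow_mul_exp_neg_mul_Ioi ha hβ, ← lintegral_const_mul' _ _ ENNReal.ofReal_ne_top,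
    ← lintegral_indicator measurableSet_Ioi, ← lintegral_add_right_eq_self _ s,
    ← lintegral_indicator measurableSet_Ioi]
  refine lintegral_congr fun u => ?_
  by_cases hu : 0 < u
  · have h1 : u + s ∈ Set.Ioi s := by simpa using hu
    rw [Set.indicator_of_mem h1, Set.indicator_of_mem (Set.mem_Ioi.2 hu), add_sub_cancel_right,
      abs_of_pos hu, ← ENNReal.ofReal_mul (Real.exp_nonneg _), mul_left_comm, ← Real.exp_add]
    congr 3
    ring
  · have h1 : u + s ∉ Set.Ioi s := by simpa using hu
    rw [Set.indicator_of_notMem h1, Set.indicator_of_notMem (by simpa using hu)]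

lemma lintegral_lintegral_Ioi_abs_sub_rpow_mul_exp {a β : ℝ} (ha : 0 < a) (hβ : 0 < β) :
    ∫⁻ s in Set.Ioi (0 : ℝ), ∫⁻ r in Set.Ioi s,
        ENNReal.ofReal (|r - s| ^ (a - 1) * Real.exp (-(β * (r + s))))
      = ENNReal.ofReal ((1 / β) ^ (a + 1) * Real.Gamma a / 2) := by
  simp_rw [lintegral_Ioi_abs_sub_rpow_mul_exp ha hβ]
  rw [lintegral_mul_const' _ _ ENNReal.ofReal_ne_top]
  have h1 := lintegral_rpow_mul_exp_neg_mul_Ioi one_pos (show 0 < 2 * β by positivity)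
  simp only [sub_self, Real.rpow_zero, one_mul, Real.rpow_one, Real.Gamma_one, mul_one] at h1
  rw [h1, ← ENNReal.ofReal_mul (by positivity), Real.rpow_add (by positivity), Real.rpow_one]
  congr 1
  field_simp

/-- The Laplace-type transform of `|r - s| ^ (a - 1)` along the diagonal direction. -/
lemma lintegral_quadrant_abs_sub_rpow_mul_exp {a β : ℝ} (ha : 0 < a) (hβ : 0 < β) :
    ∫⁻ s in Set.Ioi (0 : ℝ), ∫⁻ r in Set.Ioi (0 : ℝ),
        ENNReal.ofReal (|r - s| ^ (a - 1) * Real.exp (-(β * (r + s))))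
      = ENNReal.ofReal ((1 / β) ^ (a + 1) * Real.Gamma a) := by
  set g : ℝ → ℝ → ℝ≥0∞ := fun s r =>
    ENNReal.ofReal (|r - s| ^ (a - 1) * Real.exp (-(β * (r + s)))) with hg
  have hgm : Measurable (Function.uncurry g) := by
    simp only [hg, Function.uncurry_def]; fun_prop
  have hsymm : ∀ s r, g s r = g r s := fun s r => by simp only [hg]; rw [abs_sub_comm, add_comm r]
  -- Split at the diagonal. The half r ≤ s is written with an indicator so that its domain does not
  -- depend on s and Tonelli applies; by symmetry it equals the other half.
  have hsplit : ∀ s ∈ Set.Ioi (0 : ℝ), ∫⁻ r in Set.Ioi (0 : ℝ), g s r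
      = (∫⁻ r in Set.Ioi s, g s r)
        + ∫⁻ r in Set.Ioi (0 : ℝ), (Set.Iic s).indicator (g s) r := by
    intro s hs
    rw [setLIntegral_indicator measurableSet_Iic, ← lintegral_inter_add_sdiff (g s)
      (Set.Ioi (0 : ℝ)) (measurableSet_Ioi (a := s)), Set.Ioi_inter_Ioi,
      sup_eq_right.2 (le_of_lt hs)]
    congr 2
    congr 1
    ext r; simp [and_comm]
  have hind : Measurable (Function.uncurry fun s r => (Set.Iic s).indicator (g s) r) := by
    have h1 : (Function.uncurry fun s r => (Set.Iic s).indicator (g s) r)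
        = {p : ℝ × ℝ | p.2 ≤ p.1}.indicator (Function.uncurry g) := by
      ext ⟨s, r⟩; simp [Set.indicator, Function.uncurry]
    rw [h1]
    exact hgm.indicator (measurableSet_le measurable_snd measurable_fst)
  have hm1 : Measurable fun s => ∫⁻ r in Set.Ioi (0 : ℝ), (Set.Iic s).indicator (g s) r :=
    hind.lintegral_prod_right
  have hswap : ∫⁻ s in Set.Ioi (0 : ℝ), ∫⁻ r in Set.Ioi (0 : ℝ), (Set.Iic s).indicator (g s) r
      = ∫⁻ s in Set.Ioi (0 : ℝ), ∫⁻ r in Set.Ioi s, g s r := by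
    rw [lintegral_lintegral_swap hind.aemeasurable]
    refine setLIntegral_congr_fun measurableSet_Ioi fun r hr => ?_
    have h1 : ∀ s, (Set.Iic s).indicator (g s) r = (Set.Ici r).indicator (g r) s := by
      intro s; simp only [Set.indicator, Set.mem_Iic, Set.mem_Ici, hsymm s r]
    simp_rw [h1]
    have h2 : Set.Ici r ⊆ Set.Ioi (0 : ℝ) := fun s hs => lt_of_lt_of_le (Set.mem_Ioi.1 hr) hs
    rw [setLIntegral_indicator measurableSet_Ici, Set.inter_eq_left.2 h2]
    -- The diagonal is null, so the value assigned there to the singular kernel is immaterial.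
    exact setLIntegral_congr Ioi_ae_eq_Ici.symm
  rw [setLIntegral_congr_fun measurableSet_Ioi hsplit, lintegral_add_right _ hm1, hswap,
    lintegral_lintegral_Ioi_abs_sub_rpow_mul_exp ha hβ, ← ENNReal.ofReal_add (by positivity)
    (by positivity), add_halves]

variable {d : ℕ} {Ω : Type*} [MeasurableSpace Ω] {P : Measure Ω} [IsProbabilityMeasure P]
  {X : ℝ≥0 → Ω → EuclideanSpace ℝ (Fin d)} {Ψ : EuclideanSpace ℝ (Fin d) → ℂ}
  {f : EuclideanSpace ℝ (Fin d) → ℝ≥0∞} {μ : Measure (EuclideanSpace ℝ (Fin d))}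

/-- The fractional resolvent of a kernel at the origin, in terms of its spectral measure. -/
lemma fracResolvent_zero_eq_lintegral [SFinite μ] (hXm : ∀ t, Measurable (X t))
    (hΨ : IsCharExponent X P Ψ) (hp : HasL2Densities X P) (h : IsKernelWithSpectralMeasure f μ)
    {H α : ℝ} (hH : 1 / 2 < H) (hα : 0 < α) :
    fracResolvent X P H α f 0 = ENNReal.ofReal (H * (2 * H - 1)) *
      (ENNReal.ofReal (Real.Gamma (2 * H - 1)) *
        ∫⁻ ξ, ENNReal.ofReal ((1 / (α + 2 * (Ψ ξ).re)) ^ (2 * H)) ∂μ) := by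
  have hρ0 := hΨ.re_nonneg
  have hρm := hΨ.measurable_re hXm hp
  have hsemi := fun t : ℝ≥0 => symmSemigroup_zero_eq_lintegral (t := t) hXm hΨ hp h
  -- Only measurability and non-negativity of Re Ψ matter from here on.
  generalize hρ : (fun ξ => (Ψ ξ).re) = ρ at hρm
  replace hρ : ∀ ξ, (Ψ ξ).re = ρ ξ := fun ξ => congrFun hρ ξ
  simp only [hρ] at hρ0 hsemi ⊢
  set k : EuclideanSpace ℝ (Fin d) → ℝ → ℝ → ℝ≥0∞ := fun ξ s r =>
    ENNReal.ofReal (|r - s| ^ (2 * H - 1 - 1) * Real.exp (-((α + 2 * ρ ξ) * (r + s)))) with hk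
  have h1 : ∀ s ∈ Set.Ioi (0 : ℝ), ∀ r ∈ Set.Ioi (0 : ℝ),
      ENNReal.ofReal (|r - s| ^ (2 * H - 2)) * ENNReal.ofReal (Real.exp (-α * (r + s))) *
        symmSemigroup X P (r + s).toNNReal f 0 = ∫⁻ ξ, k ξ s r ∂μ := by
    intro s hs r hr
    -- Densities exist only at positive times; the open quadrant avoids time 0.
    have hrs : 0 < r + s := add_pos hr hs
    rw [hsemi _ (Real.toNNReal_pos.2 hrs),
      Real.coe_toNNReal _ hrs.le, ← lintegral_const_mul' _ _
      (ENNReal.mul_ne_top ENNReal.ofReal_ne_top ENNReal.ofReal_ne_top)]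
    refine lintegral_congr fun ξ => ?_
    rw [← ENNReal.ofReal_mul (by positivity), ← ENNReal.ofReal_mul (by positivity), mul_assoc,
      ← Real.exp_add]
    simp only [hk]
    congr 3 <;> ring
  have h2 : ∀ s ∈ Set.Ioi (0 : ℝ), ∫⁻ r in Set.Ioi (0 : ℝ),
      ENNReal.ofReal (|r - s| ^ (2 * H - 2)) * ENNReal.ofReal (Real.exp (-α * (r + s))) *
        symmSemigroup X P (r + s).toNNReal f 0
      = ∫⁻ ξ, (∫⁻ r in Set.Ioi (0 : ℝ), k ξ s r) ∂μ := by
    intro s hs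
    rw [setLIntegral_congr_fun measurableSet_Ioi (h1 s hs), lintegral_lintegral_swap]
    have : Measurable fun p : ℝ × EuclideanSpace ℝ (Fin d) => k p.2 s p.1 := by
      simp only [hk]; fun_prop
    exact this.aemeasurable
  have h3 : ∀ ξ, ∫⁻ s in Set.Ioi (0 : ℝ), ∫⁻ r in Set.Ioi (0 : ℝ), k ξ s r
      = ENNReal.ofReal (Real.Gamma (2 * H - 1))
        * ENNReal.ofReal ((1 / (α + 2 * ρ ξ)) ^ (2 * H)) := by
    intro ξ
    have hβ : 0 < α + 2 * ρ ξ := by linarith [hρ0 ξ]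
    rw [lintegral_quadrant_abs_sub_rpow_mul_exp (by linarith) hβ, sub_add_cancel,
      ← ENNReal.ofReal_mul (Real.Gamma_pos_of_pos (by linarith)).le, mul_comm]
  rw [fracResolvent, setLIntegral_congr_fun measurableSet_Ioi h2, lintegral_lintegral_swap]
  · simp_rw [h3]
    rw [lintegral_const_mul' _ _ ENNReal.ofReal_ne_top]
  · have : Measurable fun p : (ℝ × EuclideanSpace ℝ (Fin d)) × ℝ => k p.1.2 p.1.1 p.2 := by
      simp only [hk]; fun_prop
    exact this.lintegral_prod_right'.aemeasurable

end Resolvent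

/-! ### Comparison of the integrands and conclusion. -/

lemma lintegral_lt_top_of_le_mul {α : Type*} [MeasurableSpace α] {μ : Measure α} {u v : α → ℝ}
    {c p : ℝ} (hc : 0 ≤ c) (hp : 0 ≤ p) (hu : ∀ x, 0 ≤ u x) (hv : ∀ x, 0 ≤ v x)
    (huv : ∀ x, u x ≤ c * v x) (h : ∫⁻ x, ENNReal.ofReal (v x ^ p) ∂μ < ∞) :
    ∫⁻ x, ENNReal.ofReal (u x ^ p) ∂μ < ∞ := by
  calc ∫⁻ x, ENNReal.ofReal (u x ^ p) ∂μ
      ≤ ∫⁻ x, ENNReal.ofReal (c ^ p) * ENNReal.ofReal (v x ^ p) ∂μ := by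
        refine lintegral_mono fun x => ?_
        rw [← ENNReal.ofReal_mul (by positivity), ← Real.mul_rpow hc (hv x)]
        exact ENNReal.ofReal_le_ofReal (Real.rpow_le_rpow (hu x) (huv x) hp)
    _ = ENNReal.ofReal (c ^ p) * ∫⁻ x, ENNReal.ofReal (v x ^ p) ∂μ :=
        lintegral_const_mul' _ _ ENNReal.ofReal_ne_top
    _ < ∞ := ENNReal.mul_lt_top ENNReal.ofReal_lt_top h

end FractionalSPDE

end

theorem mainTheorem8 {d : ℕ} {Ω : Type*} [MeasurableSpace Ω] (P : Measure Ω)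
    [IsProbabilityMeasure P]
    (X : ℝ≥0 → Ω → EuclideanSpace ℝ (Fin d)) (hX : FractionalSPDE.IsLevyProcess X P)
    (Ψ : EuclideanSpace ℝ (Fin d) → ℂ) (hΨ : FractionalSPDE.IsCharExponent X P Ψ)
    (hp : FractionalSPDE.HasL2Densities X P)
    (H : ℝ) (hH : 1 / 2 < H) (hH1 : H < 1)
    (f : EuclideanSpace ℝ (Fin d) → ℝ≥0∞) (μ : Measure (EuclideanSpace ℝ (Fin d)))
    (hfμ : FractionalSPDE.IsKernelWithSpectralMeasure f μ)
    (hμ : ∃ g : EuclideanSpace ℝ (Fin d) → ℝ≥0, Measurable g ∧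
      μ = volume.withDensity (fun ξ => (g ξ : ℝ≥0∞)))
    (hf : ∀ x, f x < ∞ ↔ x ≠ 0) :
    (∫⁻ ξ, ENNReal.ofReal ((1 / (1 + (Ψ ξ).re)) ^ (2 * H)) ∂μ < ∞) ↔
      ∀ α : ℝ, 0 < α → FractionalSPDE.fracResolvent X P H α f 0 < ∞ := by
  -- The density of μ enters here: s-finiteness justifies Fubini and Tonelli.
  have hμs : SFinite μ := by
    obtain ⟨g, -, rfl⟩ := hμ
    infer_instance
  have hΨ0 := hΨ.re_nonneg
  constructor
  · intro h α hα
    rw [FractionalSPDE.fracResolvent_zero_eq_lintegral hX.measurable hΨ hp hfμ hH hα]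
    refine ENNReal.mul_lt_top ENNReal.ofReal_lt_top (ENNReal.mul_lt_top ENNReal.ofReal_lt_top ?_)
    have hm : 0 < min α 1 := lt_min hα one_pos
    -- As ρ ≥ 0, min(α, 1)(1 + ρ) ≤ α + 2ρ.
    refine FractionalSPDE.lintegral_lt_top_of_le_mul (c := 1 / min α 1) (by positivity)
      (by linarith) (fun ξ => ?_) (fun ξ => ?_) (fun ξ => ?_) h
    · have := hΨ0 ξ; positivity
    · have := hΨ0 ξ; positivity
    · have := hΨ0 ξ
      rw [div_mul_div_comm, one_mul, div_le_div_iff₀ (by linarith) (by positivity)]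
      nlinarith [min_le_left α 1, min_le_right α 1]
  · intro h
    -- The single value α = 1 suffices. Since H > 1/2, both constants in the formula are positive
    -- and can be divided out.
    have h1 := h 1 one_pos
    rw [FractionalSPDE.fracResolvent_zero_eq_lintegral hX.measurable hΨ hp hfμ hH one_pos] at h1
    have hc1 : ENNReal.ofReal (H * (2 * H - 1)) ≠ 0 :=
      (ENNReal.ofReal_pos.2 (mul_pos (by linarith) (by linarith))).ne'
    have hc2 : ENNReal.ofReal (Real.Gamma (2 * H - 1)) ≠ 0 :=
      (ENNReal.ofReal_pos.2 (Real.Gamma_pos_of_pos (by linarith))).ne'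
    have h2 := ENNReal.lt_top_of_mul_ne_top_right
      (ENNReal.lt_top_of_mul_ne_top_right h1.ne hc1).ne hc2
    -- The constant comes from 1 + 2ρ ≤ 2(1 + ρ).
    refine FractionalSPDE.lintegral_lt_top_of_le_mul (c := 2) (by norm_num)
      (by linarith) (fun ξ => ?_) (fun ξ => ?_) (fun ξ => ?_) h2
    · have := hΨ0 ξ; positivity
    · have := hΨ0 ξ; positivity
    · have := hΨ0 ξ
      rw [mul_one_div, div_le_div_iff₀ (by linarith) (by linarith)]
      linarith
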